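/- **Setting.** A (finite) Bayesian game consists of players $1,\dots,n$; finite type sets $\Theta_i$; for each player $i$ and type $\theta_i\in\Theta_i$ a finite nonempty action set $A_i^{\theta_i}$, all these sets being pairwise disjoint; a prior distribution $\rho$ on $\Theta=\Theta_1\times\dots\times\Theta_n$; utilities $v_i\colon A_1\times\dots\times A_n\to\mathbb R$, where $A_i=\bigcup_{\theta_i}A_i^{\theta_i}$; and a set function $f\colon 2^E\to\mathbb R$ on $E=\bigcup_i A_i$, which defines the social welfare $v_{SW}(a)=f(\{a_1,\dots,a_n\})$. It is a *Bayesian valid utility game* if $f$ is non-negative, monotone and submodular, every $v_i$ is non-negative, and for all $a\in A_1\times\dots\times A_n$ and all $i$ $$\sum_{j} v_j(a)\le v_{SW}(a),\qquad v_i(a)\ge v_{SW}(a)-f(\{a_j: j\ne i\}).$$ The prior is *independent* if it is a product distribution. The *strategy representability gap* (SR gap) is $$\frac{\max_{s}\ \mathbb E_{\theta\sim\rho}\bigl[v_{SW}(s_1(\theta_1),\dots,s_n(\theta_n))\bigr]}{\mathbb E_{\theta\sim\rho}\bigl[\max_{a\in A_1^{\theta_1}\times\dots\times A_n^{\theta_n}}v_{SW}(a)\bigr]},$$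 where $s$ ranges over the strategy profiles, that is, $s_i(\theta_i)\in A_i^{\theta_i}$ for all $i$ and $\theta_i$; it is considered when the denominator (the optimal welfare) is positive. The SR gap of a class of games is the infimum of the SR gaps of its members. **The coverage games.** For each $n$ let $\mathcal G_n$ be the following game with $n$ players and a universe $U$ with $|U|=n$. The type of each player is a random subset $T\subseteq U$ containing each element of $U$ independently with probability $2\log n/n$, independently across players (for $n=0$ this probability is immaterial). A player of type $T\neq\emptyset$ chooses an element of $T$, and a player of type $T=\emptyset$ has only a null action, which covers nothing. The value of $f$ on a set of actions is the number of elements of $U$ chosen by at least one of them, and $v_i$ is player $i$'s marginal contribution to the social welfare. **Proposition.** 1. Every $\mathcal G_n$ is a Bayesian valid utility game with an independent prior, and its optimal welfare is positive if $n\ge 2$. 2. The SR gap of $\mathcal G_n$ tends to $1-1/e$ as $n\to\infty$. 3. Consequently the bound $1-1/e$ is tight: the infimum of the SR gaps of all Bayesian valid utility games with independent prior (and positive optimal welfare) equals $1-1/e$. -/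

import Mathlib

/-- A finite Bayesian game with type-dependent action sets and a set function on the actions.
The action set of player `i` with type `θ` is the type `A i θ`, so that action sets belonging to
different players or different types are automatically disjoint. -/
structure BayesianGame where
  /-- the number of players -/
  n : ℕ
  /-- the types of each player -/
  Θ : Fin n → Type
  fintypeΘ : ∀ i, Fintype (Θ i)
  /-- the actions available to each player at each type -/
  A : (i : Fin n) → Θ i → Type
  finiteA : ∀ i θ, Finite (A i θ)
  nonemptyA : ∀ i θ, Nonempty (A i θ)
  /-- the common prior distribution on type profiles -/
  prior : (∀ i, Θ i) → ℝ
  prior_mem : prior ∈ stdSimplex ℝ (∀ i, Θ i)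
  /-- the utility functions, defined on all profiles of actions in `⋃ θ, A i θ` -/
  v : (i : Fin n) → (∀ j, Σ θ : Θ j, A j θ) → ℝ
  /-- the set function on sets of actions that represents social welfare -/
  f : Set (Σ i : Fin n, Σ θ : Θ i, A i θ) → ℝ

attribute [instance] BayesianGame.fintypeΘ BayesianGame.finiteA BayesianGame.nonemptyA

namespace BayesianGame

/-- The ground set `E` of all actions of all players. -/
abbrev E (G : BayesianGame) : Type := Σ i : Fin G.n, Σ θ : G.Θ i, G.A i θ

/-- Type profiles. -/
abbrev TypeProfile (G : BayesianGame) : Type := ∀ i, G.Θ i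

/-- Action profiles: each player picks an action from the union of her action sets. -/
abbrev Profile (G : BayesianGame) : Type := ∀ i, Σ θ : G.Θ i, G.A i θ

/-- Action profiles that are feasible at the type profile `θ`. -/
abbrev ProfileAt (G : BayesianGame) (θ : G.TypeProfile) : Type := ∀ i, G.A i (θ i)

/-- Strategy profiles: each player picks a feasible action for each of her own types. -/
abbrev StrategyProfile (G : BayesianGame) : Type := ∀ i, ∀ θ : G.Θ i, G.A i θ

/-- A feasible action profile at `θ`, seen as an action profile. -/
def toProfile (G : BayesianGame) {θ : G.TypeProfile} (a : G.ProfileAt θ) : G.Profile :=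
  fun i => ⟨θ i, a i⟩

/-- The set of actions `{a_j | j ∈ J}` played by the players in `J`. -/
def played (G : BayesianGame) (a : G.Profile) (J : Set (Fin G.n)) : Set G.E :=
  (fun j => (⟨j, a j⟩ : G.E)) '' J

/-- Social welfare `f({a_1, …, a_n})`. -/
def SW (G : BayesianGame) (a : G.Profile) : ℝ := G.f (G.played a Set.univ)

/-- Social welfare when player `i` selects nothing and the others play `a`. -/
def SWWithout (G : BayesianGame) (i : Fin G.n) (a : G.Profile) : ℝ := G.f (G.played a {i}ᶜ)

/-- The set function is non-negative, monotone and submodular. -/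
def HasSubmodularWelfare (G : BayesianGame) : Prop :=
  (∀ X, 0 ≤ G.f X) ∧ (∀ X Y, X ⊆ Y → G.f X ≤ G.f Y) ∧
    ∀ (X Y : Set G.E) (u : G.E), X ⊆ Y → u ∉ Y →
      G.f (Y ∪ {u}) - G.f Y ≤ G.f (X ∪ {u}) - G.f X

/-- Bayesian valid utility games: non-negative utilities, non-negative monotone submodular social
welfare, the total utility condition and the marginal contribution condition. -/
def IsValidUtilityGame (G : BayesianGame) : Prop :=
  G.HasSubmodularWelfare ∧ (∀ i a, 0 ≤ G.v i a) ∧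
    (∀ a, ∑ i, G.v i a ≤ G.SW a) ∧
    ∀ i a, G.SW a - G.SWWithout i a ≤ G.v i a

/-- The prior is a product distribution. -/
def IsIndependent (G : BayesianGame) : Prop :=
  ∃ ρ : ∀ i, G.Θ i → ℝ, (∀ i, ρ i ∈ stdSimplex ℝ (G.Θ i)) ∧
    ∀ θ, G.prior θ = ∏ i, ρ i (θ i)

/-- Expected social welfare of a strategy profile. -/
def strategyWelfare (G : BayesianGame) (s : G.StrategyProfile) : ℝ :=
  ∑ θ : G.TypeProfile, G.prior θ * G.SW (G.toProfile fun i => s i (θ i))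

/-- The largest expected social welfare of a strategy profile
(a supremum over a finite nonempty type, so a maximum). -/
noncomputable def bestStrategyWelfare (G : BayesianGame) : ℝ :=
  ⨆ s : G.StrategyProfile, G.strategyWelfare s

/-- The optimal social welfare: the expectation over `θ` of the largest social welfare of a
feasible action profile at `θ` (a supremum over a finite nonempty type, so a maximum). -/
noncomputable def optWelfare (G : BayesianGame) : ℝ :=
  ∑ θ : G.TypeProfile, G.prior θ * ⨆ a : G.ProfileAt θ, G.SW (G.toProfile a)

/-- The strategy representability gap; it is meaningful when `0 < G.optWelfare`. -/
noncomputable def srGap (G : BayesianGame) : ℝ := G.bestStrategyWelfare / G.optWelfare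

end BayesianGame

/-- The probability that a random subset of an `n`-element set, containing each element
independently with probability `p`, equals `T`. -/
def randomSubsetWeight (n : ℕ) (p : ℝ) (T : Finset (Fin n)) : ℝ :=
  p ^ T.card * (1 - p) ^ (n - T.card)

theorem randomSubsetWeight_mem (n : ℕ) (p : ℝ) (h0 : 0 ≤ p) (h1 : p ≤ 1) :
    randomSubsetWeight n p ∈ stdSimplex ℝ (Finset (Fin n)) := by
  refine ⟨fun T => mul_nonneg (pow_nonneg h0 _) (pow_nonneg (by linarith) _), ?_⟩
  have h := Fintype.sum_pow_mul_eq_add_pow (Fin n) p (1 - p)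
  simpa [randomSubsetWeight] using h

theorem prod_mem_stdSimplex {n : ℕ} {T : Type} [Fintype T] (w : T → ℝ)
    (hw : w ∈ stdSimplex ℝ T) :
    (fun θ : Fin n → T => ∏ i, w (θ i)) ∈ stdSimplex ℝ (Fin n → T) := by
  refine ⟨fun θ => Finset.prod_nonneg fun i _ => hw.1 _, ?_⟩
  have h := Fintype.sum_pow w n
  rw [hw.2, one_pow] at h
  exact h.symm

/-- The density `2 log n / n` of the random action sets. -/
noncomputable def coverageDensity (n : ℕ) : ℝ := 2 * Real.log n / n

theorem coverageDensity_nonneg (n : ℕ) : 0 ≤ coverageDensity n :=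
  div_nonneg (mul_nonneg two_pos.le (Real.log_natCast_nonneg n)) n.cast_nonneg

theorem coverageDensity_le_one (n : ℕ) : coverageDensity n ≤ 1 := by
  unfold coverageDensity
  rcases Nat.eq_zero_or_pos n with rfl | hn
  · simp
  have hn' : (0 : ℝ) < n := by exact_mod_cast hn
  rw [div_le_one hn']
  have h2 : Real.log ((n : ℝ) / 2) ≤ n / 2 - 1 := Real.log_le_sub_one_of_pos (by positivity)
  rw [Real.log_div hn'.ne' two_ne_zero] at h2
  have h3 := Real.log_two_lt_d9
  linarith

/-- The actions of a player of type `T ⊆ U = Fin n`: the elements of `T` or, if `T` is empty, a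
single null action `none`. -/
abbrev CoverageAction (n : ℕ) (T : Finset (Fin n)) : Type :=
  {o : Option (Fin n) // (∀ u, o = some u → u ∈ T) ∧ (o = none → T = ∅)}

theorem coverageAction_nonempty (n : ℕ) (T : Finset (Fin n)) : Nonempty (CoverageAction n T) := by
  rcases T.eq_empty_or_nonempty with rfl | ⟨u, hu⟩
  · exact ⟨⟨none, by simp, fun _ => rfl⟩⟩
  · exact ⟨⟨some u, by simpa using hu, by simp⟩⟩

/-- The number of elements of the universe that are covered by the actions in `X`
(the action `some u` covers `u`, the null action covers nothing). -/
noncomputable def coverage (n : ℕ)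
    (X : Set (Σ _ : Fin n, Σ T : Finset (Fin n), CoverageAction n T)) : ℝ :=
  ((Set.ncard {u : Fin n | ∃ e ∈ X, e.2.2.1 = some u} : ℕ) : ℝ)

/-- The coverage game with `n` players and an `n`-element universe. The type of a player is her
action set, a random subset of the universe that contains each element independently with
probability `2 log n / n`; the types of different players are independent. Social welfare is the
number of covered elements, and the utility of a player is her marginal contribution to it. -/
noncomputable def coverageGame (n : ℕ) : BayesianGame where
  n := n
  Θ := fun _ => Finset (Fin n)
  fintypeΘ := fun _ => inferInstance
  A := fun _ T => CoverageAction n T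
  finiteA := fun _ _ => inferInstance
  nonemptyA := fun _ T => coverageAction_nonempty n T
  prior := fun θ => ∏ i, randomSubsetWeight n (coverageDensity n) (θ i)
  prior_mem := prod_mem_stdSimplex _
    (randomSubsetWeight_mem n _ (coverageDensity_nonneg n) (coverageDensity_le_one n))
  v := fun i a =>
    coverage n ((fun j => ⟨j, a j⟩) '' Set.univ) - coverage n ((fun j => ⟨j, a j⟩) '' {i}ᶜ)
  f := coverage n

/-! Lower bound. Fix an optimal action profile for every type profile. Each player completes her own
type by independently sampled types of the others and plays her part of the optimum at the completed
profile. Since the prior is a product, the completed profiles of the `n` players are `n` independent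
samples of the prior (`sum_prod_mul_diagonal_update`). Each player's action thus has the same law as
in the optimum, but the actions are independent across players. By `correlation_gap` this costs at
most a factor `1 - 1 / e`, and some realisation of the sampled profiles is a deterministic strategy
profile at least as good as the average.

Upper bound. In the coverage game with density `p`, a strategy makes a player choose `u` with
probability at most `p`, independently of the others. So the chance that `u` stays uncovered is
about `exp (-x)`, where `x` is the expected number of players choosing `u`. These loads sum to at
most `n`, so convexity leaves about `n / e` elements uncovered (`mul_exp_le_sum_prod`). With full
information, a greedy choice already covers `n - 1 / p` elements in expectation
(`mul_sub_expected_greedyCover_le`). As `p → 0` and `n * p → ∞`, the ratio of the two bounds tends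
to `1 - 1 / e`. -/

/-! ### The multilinear extension on the diagonal and its differential inequality. -/

theorem prod_ite_eq_randomSubsetWeight {n : ℕ} (t : ℝ) (I : Finset (Fin n)) :
    ∏ i, (if i ∈ I then t else 1 - t) = randomSubsetWeight n t I := by
  rw [Finset.prod_ite, Finset.prod_const, Finset.prod_const, randomSubsetWeight]
  congr 2
  · simp
  · rw [Finset.filter_not, Finset.filter_mem_eq_inter, Finset.univ_inter,
      Finset.card_sdiff_of_subset (Finset.subset_univ I), Finset.card_univ, Fintype.card_fin]

theorem sum_finset_eq_sum_powerset_erase {n : ℕ} (i : Fin n) (g : Finset (Fin n) → ℝ) :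
    ∑ I, g I = ∑ I ∈ (Finset.univ.erase i).powerset, (g I + g (insert i I)) := by
  have h := Finset.sum_powerset_insert (Finset.notMem_erase i Finset.univ) g
  rw [Finset.insert_erase (Finset.mem_univ i), Finset.powerset_univ] at h
  rw [h, Finset.sum_add_distrib]

/-- The derivative in direction `i` of the multilinear extension of `h`. -/
theorem sum_prod_erase_mul_sign {n : ℕ} (h : Finset (Fin n) → ℝ) (t : ℝ) (i : Fin n) :
    ∑ I, ((∏ j ∈ Finset.univ.erase i, (if j ∈ I then t else 1 - t)) *
        (if i ∈ I then 1 else -1)) * h I =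
      ∑ I, randomSubsetWeight n t I * (h (insert i I) - h (I.erase i)) := by
  simp_rw [← prod_ite_eq_randomSubsetWeight]
  rw [sum_finset_eq_sum_powerset_erase i, sum_finset_eq_sum_powerset_erase i]
  refine Finset.sum_congr rfl fun I hI => ?_
  have hi : i ∉ I := fun hi => Finset.notMem_erase i Finset.univ (Finset.mem_powerset.1 hI hi)
  have hP : ∏ j ∈ Finset.univ.erase i, (if j ∈ insert i I then t else 1 - t) =
      ∏ j ∈ Finset.univ.erase i, (if j ∈ I then t else 1 - t) :=
    Finset.prod_congr rfl fun j hj => by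
      simp [Finset.ne_of_mem_erase hj]
  rw [← Finset.mul_prod_erase Finset.univ _ (Finset.mem_univ i),
    ← Finset.mul_prod_erase Finset.univ _ (Finset.mem_univ i), hP]
  simp [hi]
  ring

/-- The multilinear extension of `h` on the diagonal. -/
noncomputable def diagonalExtension {n : ℕ} (h : Finset (Fin n) → ℝ) (t : ℝ) : ℝ :=
  ∑ I, randomSubsetWeight n t I * h I

theorem hasDerivAt_diagonalExtension {n : ℕ} (h : Finset (Fin n) → ℝ) (t : ℝ) :
    HasDerivAt (diagonalExtension h)
      (∑ I, randomSubsetWeight n t I * ∑ i, (h (insert i I) - h (I.erase i))) t := by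
  have h1 : ∀ I : Finset (Fin n), HasDerivAt (fun t => randomSubsetWeight n t I * h I)
      ((∑ i, (∏ j ∈ Finset.univ.erase i, (if j ∈ I then t else 1 - t)) *
        (if i ∈ I then 1 else -1)) * h I) t := by
    intro I
    simp_rw [← prod_ite_eq_randomSubsetWeight]
    have := HasDerivAt.fun_finsetProd (u := Finset.univ) (x := t)
      (f := fun i t => if i ∈ I then t else 1 - t) (f' := fun i => if i ∈ I then 1 else -1)
      (fun i _ => by
        by_cases hi : i ∈ I
        · simpa [hi] using hasDerivAt_id' t
        · simpa [hi] using (hasDerivAt_id' t).const_sub 1)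
    simpa using this.mul_const (h I)
  have h2 := HasDerivAt.fun_sum (u := Finset.univ) fun I _ => h1 I
  refine HasDerivAt.congr_deriv (f := diagonalExtension h) h2 ?_
  simp_rw [Finset.sum_mul, Finset.mul_sum]
  rw [Finset.sum_comm]
  conv_rhs => rw [Finset.sum_comm]
  exact Finset.sum_congr rfl fun i _ => sum_prod_erase_mul_sign h t i

theorem diagonalExtension_zero {n : ℕ} (h : Finset (Fin n) → ℝ) :
    diagonalExtension h 0 = h ∅ := by
  rw [diagonalExtension, Finset.sum_eq_single ∅]
  · simp [randomSubsetWeight]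
  · intro I _ hI
    simp [randomSubsetWeight, hI]
  · simp

theorem diagonalExtension_one {n : ℕ} (h : Finset (Fin n) → ℝ) :
    diagonalExtension h 1 = h Finset.univ := by
  rw [diagonalExtension, Finset.sum_eq_single Finset.univ]
  · simp [randomSubsetWeight]
  · intro I _ hI
    have : I.card < n := by simpa using Finset.card_lt_card (Finset.ssubset_univ_iff.2 hI)
    simp [randomSubsetWeight, (Nat.sub_pos_of_lt this).ne']
  · simp

/-- Averaging `hc` over a random set of density `t` gives `F' ≥ c - F` for the diagonal extension
`F` of `h`. Hence `exp t * (F t - c)` is nondecreasing on `[0, 1]`, and comparing the endpoints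
gives the bound. -/
theorem le_of_le_marginals {n : ℕ} (h : Finset (Fin n) → ℝ) (c : ℝ) (h0 : 0 ≤ h ∅)
    (hc : ∀ I, c ≤ h I + ∑ i, (h (insert i I) - h (I.erase i))) :
    (1 - 1 / Real.exp 1) * c ≤ h Finset.univ := by
  have hd : ∀ t, HasDerivAt (fun t => Real.exp t * (diagonalExtension h t - c))
      (Real.exp t * (diagonalExtension h t - c) + Real.exp t *
        ∑ I, randomSubsetWeight n t I * ∑ i, (h (insert i I) - h (I.erase i))) t :=
    fun t => (Real.hasDerivAt_exp t).mul ((hasDerivAt_diagonalExtension h t).sub_const c)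
  have hm : MonotoneOn (fun t => Real.exp t * (diagonalExtension h t - c)) (Set.Icc 0 1) := by
    refine monotoneOn_of_deriv_nonneg (convex_Icc 0 1)
      (fun t _ => (hd t).continuousAt.continuousWithinAt)
      (fun t _ => (hd t).differentiableAt.differentiableWithinAt) fun t ht => ?_
    rw [interior_Icc] at ht
    rw [(hd t).deriv, ← mul_add]
    refine mul_nonneg (Real.exp_pos t).le ?_
    have hw := randomSubsetWeight_mem n t ht.1.le ht.2.le
    have : c = ∑ I, randomSubsetWeight n t I * c := by rw [← Finset.sum_mul, hw.2, one_mul]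
    rw [diagonalExtension, this, ← Finset.sum_sub_distrib, ← Finset.sum_add_distrib]
    refine Finset.sum_nonneg fun I _ => ?_
    rw [← mul_sub, ← mul_add]
    exact mul_nonneg (hw.1 I) (by linarith [hc I])
  have h01 := hm (Set.left_mem_Icc.2 zero_le_one) (Set.right_mem_Icc.2 zero_le_one) zero_le_one
  simp only [diagonalExtension_zero, diagonalExtension_one, Real.exp_zero, one_mul] at h01
  have he := Real.exp_pos 1
  have : -c / Real.exp 1 ≤ h Finset.univ - c := by
    rw [div_le_iff₀ he]; linarith
  have h2 : (1 - 1 / Real.exp 1) * c = c + -c / Real.exp 1 := by ring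
  linarith

/-! ### Marginals of monotone submodular set functions. -/

section Submodular

variable {E : Type*} {f : Set E → ℝ}

/-- Monotonicity removes the restriction `u ∉ Y`: for `u ∈ Y` the left side vanishes and the right
side is non-negative. -/
theorem marginal_le_marginal (hmono : ∀ X Y, X ⊆ Y → f X ≤ f Y)
    (hsub : ∀ (X Y : Set E) (u : E), X ⊆ Y → u ∉ Y → f (Y ∪ {u}) - f Y ≤ f (X ∪ {u}) - f X)
    {X Y : Set E} (hXY : X ⊆ Y) (u : E) : f (Y ∪ {u}) - f Y ≤ f (X ∪ {u}) - f X := by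
  by_cases hu : u ∈ Y
  · rw [Set.union_eq_self_of_subset_right (Set.singleton_subset_iff.2 hu), sub_self, sub_nonneg]
    exact hmono _ _ Set.subset_union_left
  · exact hsub X Y u hXY hu

theorem le_add_sum_marginals (hmono : ∀ X Y, X ⊆ Y → f X ≤ f Y)
    (hsub : ∀ (X Y : Set E) (u : E), X ⊆ Y → u ∉ Y → f (Y ∪ {u}) - f Y ≤ f (X ∪ {u}) - f X)
    {ι : Type*} (S : Set E) (e : ι → E) (J : Finset ι) :
    f (S ∪ e '' J) ≤ f S + ∑ i ∈ J, (f (S ∪ {e i}) - f S) := by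
  classical
  induction J using Finset.induction_on with
  | empty => simp
  | insert i J hi ih =>
    rw [Finset.sum_insert hi]
    have h1 := marginal_le_marginal hmono hsub
      (Set.subset_union_left : S ⊆ S ∪ e '' (J : Set ι)) (e i)
    have h2 : S ∪ e '' ((insert i J : Finset ι) : Set ι) = S ∪ e '' (J : Set ι) ∪ {e i} := by
      rw [Finset.coe_insert, Set.image_insert_eq, Set.insert_eq, Set.union_comm {e i},
        Set.union_assoc]
    rw [h2]
    linarith

end Submodular

/-! ### Resampling and the correlation gap. -/

/-- Resampling one coordinate of an i.i.d. tuple does not change its distribution. -/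
theorem sum_prod_mul_update {n : ℕ} {Ω : Type*} [Fintype Ω] (ρ : Ω → ℝ) (hρ : ∑ x, ρ x = 1)
    (i : Fin n) (g : (Fin n → Ω) → ℝ) :
    ∑ ω : Fin n → Ω, ∑ θ, (∏ j, ρ (ω j)) * ρ θ * g (Function.update ω i θ) =
      ∑ ω : Fin n → Ω, (∏ j, ρ (ω j)) * g ω := by
  -- Swapping `ω i` with the extra sample is an involution that preserves the product weight.
  let σ : (Fin n → Ω) × Ω → (Fin n → Ω) × Ω := fun p => (Function.update p.1 i p.2, p.1 i)
  have hσ : Function.Involutive σ := fun p => by simp [σ]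
  have hw : ∀ p : (Fin n → Ω) × Ω, (∏ j, ρ ((σ p).1 j)) * ρ (σ p).2 =
      (∏ j, ρ (p.1 j)) * ρ p.2 := by
    intro p
    rw [← Finset.mul_prod_erase Finset.univ _ (Finset.mem_univ i),
      ← Finset.mul_prod_erase Finset.univ (fun j => ρ (p.1 j)) (Finset.mem_univ i)]
    have : ∏ j ∈ Finset.univ.erase i, ρ ((σ p).1 j) = ∏ j ∈ Finset.univ.erase i, ρ (p.1 j) :=
      Finset.prod_congr rfl fun j hj => by simp [σ, Finset.ne_of_mem_erase hj]
    rw [this]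
    simp only [σ, Function.update_self]
    ring
  calc _ = ∑ p : (Fin n → Ω) × Ω, (∏ j, ρ (p.1 j)) * ρ p.2 * g (σ p).1 := by
        rw [Fintype.sum_prod_type]
    _ = ∑ p : (Fin n → Ω) × Ω, (∏ j, ρ (p.1 j)) * ρ p.2 * g p.1 := by
        refine Fintype.sum_equiv hσ.toPerm _ _ fun p => ?_
        rw [Function.Involutive.coe_toPerm, hw]
    _ = _ := by
        rw [Fintype.sum_prod_type]
        refine Finset.sum_congr rfl fun ω _ => ?_
        simp_rw [mul_right_comm _ _ (g _)]
        rw [← Finset.mul_sum, hρ, mul_one]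

/-- The correlation gap of monotone submodular functions is at least `1 - 1 / e`. -/
theorem correlation_gap {n : ℕ} {Ω E : Type*} [Fintype Ω] (ρ : Ω → ℝ) (hρ : ρ ∈ stdSimplex ℝ Ω)
    (e : Fin n → Ω → E) (f : Set E → ℝ) (hf : ∀ X, 0 ≤ f X)
    (hmono : ∀ X Y, X ⊆ Y → f X ≤ f Y)
    (hsub : ∀ (X Y : Set E) (u : E), X ⊆ Y → u ∉ Y →
      f (Y ∪ {u}) - f Y ≤ f (X ∪ {u}) - f X) :
    (1 - 1 / Real.exp 1) * ∑ θ, ρ θ * f ((fun i => e i θ) '' Set.univ) ≤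
      ∑ ω : Fin n → Ω, (∏ i, ρ (ω i)) * f ((fun i => e i (ω i)) '' Set.univ) := by
  have hP : ∀ ω : Fin n → Ω, 0 ≤ ∏ i, ρ (ω i) := fun ω => Finset.prod_nonneg fun i _ => hρ.1 _
  have hP1 : ∑ ω : Fin n → Ω, ∏ i, ρ (ω i) = 1 := by
    rw [← Fintype.sum_pow, hρ.2, one_pow]
  let g : Finset (Fin n) → (Fin n → Ω) → ℝ := fun I ω => f ((fun i => e i (ω i)) '' (I : Set _))
  let h : Finset (Fin n) → ℝ := fun I => ∑ ω : Fin n → Ω, (∏ i, ρ (ω i)) * g I ω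
  have key := le_of_le_marginals h (∑ θ, ρ θ * f ((fun i => e i θ) '' Set.univ))
    (Finset.sum_nonneg fun ω _ => mul_nonneg (hP ω) (hf _)) ?_
  · simpa [h, g] using key
  intro I
  -- Pointwise form of the hypothesis of `le_of_le_marginals`. The marginal of `e i θ` is taken over
  -- `I.erase i` rather than `I`, so that `θ` takes the place of `ω i`; the enlarged set then
  -- depends on the resampled tuple alone, which has the law of `ω`.
  have pt : ∀ (ω : Fin n → Ω) (θ : Ω), f ((fun i => e i θ) '' Set.univ) ≤
      g I ω + ∑ i, (g (insert i I) (Function.update ω i θ) - g (I.erase i) ω) := by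
    intro ω θ
    have h1 := le_add_sum_marginals hmono hsub ((fun i => e i (ω i)) '' (I : Set _))
      (fun i => e i θ) Finset.univ
    rw [Finset.coe_univ] at h1
    refine ((hmono _ _ Set.subset_union_right).trans h1).trans ?_
    refine add_le_add le_rfl (Finset.sum_le_sum fun i _ => ?_)
    have h2 := marginal_le_marginal hmono hsub
      (Set.image_mono (f := fun i => e i (ω i)) (Finset.coe_subset.2 (Finset.erase_subset i I)))
      (e i θ)
    refine h2.trans (sub_le_sub_right (le_of_eq ?_) _)
    simp only [g]
    congr 1
    have hI : insert i I = insert i (I.erase i) := by ext j; by_cases hj : j = i <;> simp [hj]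
    rw [hI, Finset.coe_insert, Set.image_insert_eq,
      Function.update_self, Set.insert_eq, Set.union_comm]
    congr 1
    refine Set.image_congr fun j hj => ?_
    rw [Function.update_of_ne (Finset.ne_of_mem_erase hj)]
  have e1 : ∀ c : Ω → ℝ, ∑ θ, ρ θ * c θ = ∑ ω : Fin n → Ω, ∑ θ, (∏ j, ρ (ω j)) * ρ θ * c θ := by
    intro c
    simp_rw [mul_assoc, ← Finset.mul_sum]
    rw [← Finset.sum_mul, hP1, one_mul]
  have e2 : ∀ c : (Fin n → Ω) → ℝ, ∑ ω : Fin n → Ω, (∏ j, ρ (ω j)) * c ω =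
      ∑ ω : Fin n → Ω, ∑ θ, (∏ j, ρ (ω j)) * ρ θ * c ω := by
    intro c
    refine Finset.sum_congr rfl fun ω _ => ?_
    simp_rw [mul_right_comm _ _ (c ω)]
    rw [← Finset.mul_sum, hρ.2, mul_one]
  have e3 : h I + ∑ i, (h (insert i I) - h (I.erase i)) =
      ∑ ω : Fin n → Ω, ∑ θ, (∏ j, ρ (ω j)) * ρ θ *
        (g I ω + ∑ i, (g (insert i I) (Function.update ω i θ) - g (I.erase i) ω)) := by
    simp_rw [mul_add, Finset.mul_sum, Finset.sum_add_distrib]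
    congr 1
    · exact e2 _
    · simp_rw [Finset.sum_comm (s := (Finset.univ : Finset Ω)) (t := (Finset.univ : Finset (Fin n)))]
      rw [Finset.sum_comm]
      refine Finset.sum_congr rfl fun i _ => ?_
      simp_rw [mul_sub, Finset.sum_sub_distrib]
      rw [sum_prod_mul_update ρ hρ.2 i (g (insert i I)), ← e2]
  rw [e3, e1]
  refine Finset.sum_le_sum fun ω _ => Finset.sum_le_sum fun θ _ => ?_
  exact mul_le_mul_of_nonneg_left (pt ω θ) (mul_nonneg (hP ω) (hρ.1 θ))

/-! ### The lower bound for independent priors. -/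

/-- Under a product distribution, replacing in the `i`-th of `n` independent samples the `i`-th
coordinate by that of a further sample, for every `i`, gives `n` independent samples again. -/
theorem sum_prod_mul_diagonal_update {n : ℕ} {Θ : Fin n → Type*} [∀ i, Fintype (Θ i)]
    (ρ : ∀ i, Θ i → ℝ) (p : (∀ i, Θ i) → ℝ) (hp : ∀ θ, p θ = ∏ i, ρ i (θ i))
    (h1 : ∑ θ, p θ = 1) (g : (Fin n → ∀ i, Θ i) → ℝ) :
    ∑ ω : Fin n → ∀ i, Θ i, ∑ θ, (∏ i, p (ω i)) * p θ *
        g (fun i => Function.update (ω i) i (θ i)) =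
      ∑ ω : Fin n → ∀ i, Θ i, (∏ i, p (ω i)) * g ω := by
  -- This involution exchanges the diagonal of the `n` samples with the further sample. The total
  -- weight splits by coordinate, and in coordinate `i` only two factors trade places.
  let σ : (Fin n → ∀ i, Θ i) × (∀ i, Θ i) → (Fin n → ∀ i, Θ i) × (∀ i, Θ i) :=
    fun q => (fun i => Function.update (q.1 i) i (q.2 i), fun i => q.1 i i)
  have hσ : Function.Involutive σ := fun q => by simp [σ]
  have hw : ∀ q : (Fin n → ∀ i, Θ i) × (∀ i, Θ i), (∏ i, p ((σ q).1 i)) * p (σ q).2 =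
      (∏ i, p (q.1 i)) * p q.2 := by
    intro q
    simp_rw [hp]
    rw [← Finset.prod_mul_distrib, ← Finset.prod_mul_distrib]
    refine Finset.prod_congr rfl fun i _ => ?_
    rw [← Finset.mul_prod_erase Finset.univ _ (Finset.mem_univ i),
      ← Finset.mul_prod_erase Finset.univ (fun j => ρ j (q.1 i j)) (Finset.mem_univ i)]
    have : ∏ j ∈ Finset.univ.erase i, ρ j ((σ q).1 i j) =
        ∏ j ∈ Finset.univ.erase i, ρ j (q.1 i j) :=
      Finset.prod_congr rfl fun j hj => by simp [σ, Finset.ne_of_mem_erase hj]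
    rw [this]
    simp only [σ, Function.update_self]
    ring
  calc _ = ∑ q : (Fin n → ∀ i, Θ i) × (∀ i, Θ i), (∏ i, p (q.1 i)) * p q.2 * g (σ q).1 := by
        rw [Fintype.sum_prod_type]
    _ = ∑ q : (Fin n → ∀ i, Θ i) × (∀ i, Θ i), (∏ i, p (q.1 i)) * p q.2 * g q.1 := by
        refine Fintype.sum_equiv hσ.toPerm _ _ fun q => ?_
        rw [Function.Involutive.coe_toPerm, hw]
    _ = _ := by
        rw [Fintype.sum_prod_type]
        refine Finset.sum_congr rfl fun ω _ => ?_
        simp_rw [mul_right_comm _ _ (g _)]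
        rw [← Finset.mul_sum, h1, mul_one]

namespace BayesianGame

theorem strategyWelfare_le_best (G : BayesianGame) (s : G.StrategyProfile) :
    G.strategyWelfare s ≤ G.bestStrategyWelfare :=
  le_ciSup (f := G.strategyWelfare) (Set.finite_range _).bddAbove s

theorem SW_le_iSup (G : BayesianGame) {θ : G.TypeProfile} (a : G.ProfileAt θ) :
    G.SW (G.toProfile a) ≤ ⨆ a : G.ProfileAt θ, G.SW (G.toProfile a) :=
  le_ciSup (f := fun a : G.ProfileAt θ => G.SW (G.toProfile a)) (Set.finite_range _).bddAbove a

/-- With an independent prior, the best strategy profile has at least a `1 - 1 / e` fraction of the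
optimal welfare. -/
theorem optWelfare_le_best (G : BayesianGame) (hG : G.HasSubmodularWelfare)
    (hI : G.IsIndependent) :
    (1 - 1 / Real.exp 1) * G.optWelfare ≤ G.bestStrategyWelfare := by
  obtain ⟨ρ, -, hp⟩ := hI
  obtain ⟨hf, hmono, hsub⟩ := hG
  have hopt : ∀ θ : G.TypeProfile, ∃ a : G.ProfileAt θ,
      G.SW (G.toProfile a) = ⨆ a : G.ProfileAt θ, G.SW (G.toProfile a) :=
    fun θ => exists_eq_ciSup_of_finite
  choose a ha using hopt
  let b : ∀ i, G.TypeProfile → Σ θ : G.Θ i, G.A i θ := fun i θ => ⟨θ i, a θ i⟩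
  -- Player `i` of type `t` inserts `t` into her private sample `ω i` and plays her part of the
  -- optimum there. The cast is needed because the inserted type equals `t` only propositionally.
  let s : (Fin G.n → G.TypeProfile) → G.StrategyProfile := fun ω i t =>
    cast (congrArg (G.A i) (Function.update_self i t (ω i)))
      (a (Function.update (ω i) i t) i)
  have hs : ∀ (ω : Fin G.n → G.TypeProfile) (θ : G.TypeProfile), G.toProfile (fun i => s ω i (θ i)) =
      fun i => b i (Function.update (ω i) i (θ i)) := by
    intro ω θ
    funext i
    exact Sigma.ext (Function.update_self i (θ i) (ω i)).symm (cast_heq _ _)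
  have hP : ∀ ω : Fin G.n → G.TypeProfile, 0 ≤ ∏ i, G.prior (ω i) :=
    fun ω => Finset.prod_nonneg fun i _ => G.prior_mem.1 _
  have hP1 : ∑ ω : Fin G.n → G.TypeProfile, ∏ i, G.prior (ω i) = 1 := by
    rw [← Fintype.sum_pow, G.prior_mem.2, one_pow]
  have hgap := correlation_gap G.prior G.prior_mem (fun i θ => (⟨i, b i θ⟩ : G.E)) G.f hf hmono hsub
  have hopt : G.optWelfare =
      ∑ θ, G.prior θ * G.f ((fun i => (⟨i, b i θ⟩ : G.E)) '' Set.univ) := by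
    refine Finset.sum_congr rfl fun θ _ => ?_
    rw [← ha θ]
    rfl
  rw [hopt]
  refine hgap.trans ?_
  have h2 := sum_prod_mul_diagonal_update ρ G.prior hp G.prior_mem.2
    fun ω => G.f ((fun i => (⟨i, b i (ω i)⟩ : G.E)) '' Set.univ)
  rw [← h2]
  calc _ = ∑ ω : Fin G.n → G.TypeProfile, (∏ i, G.prior (ω i)) * G.strategyWelfare (s ω) := by
        refine Finset.sum_congr rfl fun ω _ => ?_
        simp_rw [strategyWelfare, hs, Finset.mul_sum, mul_assoc]
        rfl
    _ ≤ ∑ ω : Fin G.n → G.TypeProfile, (∏ i, G.prior (ω i)) * G.bestStrategyWelfare :=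
        Finset.sum_le_sum fun ω _ =>
          mul_le_mul_of_nonneg_left (G.strategyWelfare_le_best (s ω)) (hP ω)
    _ = G.bestStrategyWelfare := by rw [← Finset.sum_mul, hP1, one_mul]

theorem le_srGap (G : BayesianGame) (hG : G.HasSubmodularWelfare) (hI : G.IsIndependent)
    (h0 : 0 < G.optWelfare) : 1 - 1 / Real.exp 1 ≤ G.srGap :=
  (le_div_iff₀ h0).2 (G.optWelfare_le_best hG hI)

end BayesianGame

/-! ### Coverage games are valid utility games with an independent prior. -/

/-- Adding the players one at a time, each marginal over all other players is at most the marginal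
over those already added, and the latter telescope. -/
theorem sum_marginals_le {E ι : Type*} [Fintype ι] {f : Set E → ℝ} (hf : ∀ X, 0 ≤ f X)
    (hmono : ∀ X Y, X ⊆ Y → f X ≤ f Y)
    (hsub : ∀ (X Y : Set E) (u : E), X ⊆ Y → u ∉ Y → f (Y ∪ {u}) - f Y ≤ f (X ∪ {u}) - f X)
    (e : ι → E) : ∑ i, (f (e '' Set.univ) - f (e '' {i}ᶜ)) ≤ f (e '' Set.univ) := by
  classical
  have key : ∀ J : Finset ι, ∑ i ∈ J, (f (e '' Set.univ) - f (e '' {i}ᶜ)) ≤ f (e '' J) := by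
    intro J
    induction J using Finset.induction_on with
    | empty => simpa using hf ∅
    | insert i J hi ih =>
      rw [Finset.sum_insert hi]
      have hJ : (J : Set ι) ⊆ {i}ᶜ := fun j hj hji => hi (by
        rw [Set.mem_singleton_iff] at hji
        exact hji ▸ hj)
      have h := marginal_le_marginal hmono hsub (Set.image_mono (f := e) hJ) (e i)
      have h1 : e '' {i}ᶜ ∪ {e i} = e '' Set.univ := by
        rw [← Set.image_singleton, ← Set.image_union, Set.compl_union_self]
      have h2 : e '' J ∪ {e i} = e '' ((insert i J : Finset ι) : Set ι) := by
        rw [← Set.image_singleton, ← Set.image_union, Finset.coe_insert, Set.insert_eq,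
          Set.union_comm]
      rw [h1, h2] at h
      linarith
  simpa using key Finset.univ

theorem coverageGame_hasSubmodularWelfare (n : ℕ) : (coverageGame n).HasSubmodularWelfare := by
  refine ⟨fun X => Nat.cast_nonneg _, fun X Y hXY => ?_, fun X Y e hXY _ => ?_⟩
  · refine Nat.cast_le.2 (Set.ncard_le_ncard ?_ (Set.toFinite _))
    rintro u ⟨e, he, hu⟩
    exact ⟨e, hXY he, hu⟩
  · let C : Set (coverageGame n).E → Set (Fin n) := fun X => {u | ∃ e ∈ X, e.2.2.1 = some u}
    have hmarg : ∀ X : Set (coverageGame n).E, coverage n (X ∪ {e}) - coverage n X =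
        ((C {e} \ C X).ncard : ℝ) := by
      intro X
      have h1 : C (X ∪ {e}) = C {e} ∪ C X := by
        ext u
        simp only [C, Set.mem_ofPred_eq, Set.mem_union]
        constructor
        · rintro ⟨e', he | he, hu⟩
          exacts [Or.inr ⟨e', he, hu⟩, Or.inl ⟨e', he, hu⟩]
        · rintro (⟨e', he, hu⟩ | ⟨e', he, hu⟩)
          exacts [⟨e', Or.inr he, hu⟩, ⟨e', Or.inl he, hu⟩]
      have h2 : ((C {e} \ C X).ncard : ℝ) + (C X).ncard = (C (X ∪ {e})).ncard := by
        rw [h1]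
        exact_mod_cast Set.ncard_sdiff_add_ncard (C {e}) (C X)
      exact sub_eq_of_eq_add h2.symm
    change coverage n (Y ∪ {e}) - coverage n Y ≤ coverage n (X ∪ {e}) - coverage n X
    rw [hmarg, hmarg]
    refine Nat.cast_le.2 (Set.ncard_le_ncard (Set.sdiff_subset_sdiff_right ?_) (Set.toFinite _))
    rintro u ⟨e, he, hu⟩
    exact ⟨e, hXY he, hu⟩

theorem coverageGame_isValidUtilityGame (n : ℕ) : (coverageGame n).IsValidUtilityGame := by
  have h := coverageGame_hasSubmodularWelfare n
  obtain ⟨hf, hmono, hsub⟩ := id h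
  refine ⟨h, fun i a => ?_, fun a => ?_, fun i a => le_rfl⟩
  · exact sub_nonneg.2 (hmono _ _ (Set.image_mono (Set.subset_univ _)))
  · exact sum_marginals_le hf hmono hsub (fun j => (⟨j, a j⟩ : (coverageGame n).E))

theorem coverageGame_isIndependent (n : ℕ) : (coverageGame n).IsIndependent :=
  ⟨fun _ => randomSubsetWeight n (coverageDensity n), fun _ =>
    randomSubsetWeight_mem n _ (coverageDensity_nonneg n) (coverageDensity_le_one n),
    fun _ => rfl⟩

/-! ### Welfare of strategy profiles in the coverage games. -/

theorem sum_powerset_randomSubsetWeight {n : ℕ} (p : ℝ) (C : Finset (Fin n)) :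
    ∑ T ∈ C.powerset, randomSubsetWeight n p T = (1 - p) ^ (n - C.card) := by
  have hC : C.card ≤ n := by simpa using Finset.card_le_univ C
  have h : ∑ T ∈ C.powerset, randomSubsetWeight n p T =
      ∑ T ∈ C.powerset, p ^ T.card * (1 - p) ^ (C.card - T.card) * (1 - p) ^ (n - C.card) := by
    refine Finset.sum_congr rfl fun T hT => ?_
    have := Finset.card_le_card (Finset.mem_powerset.1 hT)
    rw [randomSubsetWeight, mul_assoc, ← pow_add]
    congr 2
    omega
  rw [h, ← Finset.sum_mul, Finset.sum_pow_mul_eq_add_pow]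
  simp

/-- From `1 / r ≤ exp (1 / r - 1)` and `1 / r - 1 = (1 - r) / r ≤ (1 - r) / (1 - p)`. -/
theorem exp_neg_div_le {p r : ℝ} (hp : p < 1) (h1 : 1 - p ≤ r) (h2 : r ≤ 1) :
    Real.exp (-((1 - p)⁻¹ * (1 - r))) ≤ r := by
  have hp' : 0 < 1 - p := sub_pos.2 hp
  have hr : 0 < r := hp'.trans_le h1
  have h3 : r⁻¹ ≤ Real.exp ((1 - p)⁻¹ * (1 - r)) := by
    have h4 : r⁻¹ * (1 - r) ≤ (1 - p)⁻¹ * (1 - r) :=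
      mul_le_mul_of_nonneg_right ((inv_le_inv₀ hr hp').2 h1) (sub_nonneg.2 h2)
    have h5 : r⁻¹ * (1 - r) + 1 = r⁻¹ := by field_simp; ring
    have := Real.add_one_le_exp ((1 - p)⁻¹ * (1 - r))
    linarith
  rw [Real.exp_neg]
  exact inv_le_of_inv_le₀ hr h3

/-- Here `r i u` plays the probability that player `i` does not choose `u`. With load `x u = ∑ i, (1
- r i u)` and `c = (1 - p)⁻¹`, the product is at least `exp (-c * x u)`; the loads average at most
`1`, so Jensen's inequality applies. -/
theorem mul_exp_le_sum_prod {n : ℕ} {p : ℝ} (hp0 : p < 1) (r : Fin n → Fin n → ℝ)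
    (h1 : ∀ i u, 1 - p ≤ r i u) (h2 : ∀ i u, r i u ≤ 1) (h3 : ∀ i, ∑ u, (1 - r i u) ≤ 1) :
    n * Real.exp (-(1 - p)⁻¹) ≤ ∑ u, ∏ i, r i u := by
  set c := (1 - p)⁻¹ with hc
  have hc0 : 0 ≤ c := inv_nonneg.2 (sub_pos.2 hp0).le
  -- The left side is the tangent of `x ↦ exp (-c * x)` at load `1`.
  have key : ∀ u, Real.exp (-c) * (1 + c - c * ∑ i, (1 - r i u)) ≤ ∏ i, r i u := by
    intro u
    calc _ ≤ Real.exp (-c) * Real.exp (c - c * ∑ i, (1 - r i u)) := by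
          refine mul_le_mul_of_nonneg_left ?_ (Real.exp_pos _).le
          have := Real.add_one_le_exp (c - c * ∑ i, (1 - r i u))
          linarith
      _ = ∏ i, Real.exp (-(c * (1 - r i u))) := by
          rw [← Real.exp_add, ← Real.exp_sum, Finset.sum_neg_distrib, ← Finset.mul_sum]
          congr 1
          ring
      _ ≤ _ := Finset.prod_le_prod (fun i _ => (Real.exp_pos _).le)
          fun i _ => exp_neg_div_le hp0 (h1 i u) (h2 i u)
  refine le_trans ?_ (Finset.sum_le_sum fun u _ => key u)
  rw [← Finset.mul_sum, Finset.sum_sub_distrib, ← Finset.mul_sum, Finset.sum_comm]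
  have h4 : ∑ i, ∑ u, (1 - r i u) ≤ n := by
    simpa using Finset.sum_le_sum fun i (_ : i ∈ Finset.univ) => h3 i
  have h5 := mul_le_mul_of_nonneg_left h4 hc0
  rw [mul_comm]
  refine mul_le_mul_of_nonneg_left ?_ (Real.exp_pos _).le
  simp only [Finset.sum_const, Finset.card_univ, Fintype.card_fin, nsmul_eq_mul]
  linarith

theorem coverage_image_univ {n : ℕ} (a : Fin n → Σ T : Finset (Fin n), CoverageAction n T) :
    coverage n ((fun j => ⟨j, a j⟩) '' Set.univ) =
      ∑ u, (1 - ∏ i, (if (a i).2.1 = some u then (0 : ℝ) else 1)) := by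
  classical
  have hset : {u : Fin n | ∃ e ∈ (fun j => (⟨j, a j⟩ :
      Σ _ : Fin n, Σ T : Finset (Fin n), CoverageAction n T)) '' Set.univ, e.2.2.1 = some u} =
      ((Finset.univ.filter fun u => ∃ i, (a i).2.1 = some u : Finset (Fin n)) : Set (Fin n)) := by
    ext u
    simp
  rw [coverage, hset, Set.ncard_coe_finset, Finset.card_filter, Nat.cast_sum]
  refine Finset.sum_congr rfl fun u _ => ?_
  by_cases h : ∃ i, (a i).2.1 = some u
  · obtain ⟨i, hi⟩ := h
    rw [Finset.prod_eq_zero (Finset.mem_univ i) (by simp [hi]), if_pos ⟨i, hi⟩]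
    simp
  · rw [if_neg h, Finset.prod_eq_one]
    · simp
    · intro i _
      rw [if_neg fun hi => h ⟨i, hi⟩]

/-- By linearity it suffices to treat each `u` alone; since types are independent, the probability
that nobody chooses `u` factors over the players. -/
theorem coverageGame_strategyWelfare (n : ℕ) (s : (coverageGame n).StrategyProfile) :
    (coverageGame n).strategyWelfare s = ∑ u : Fin n, (1 - ∏ i : Fin n, ∑ T : Finset (Fin n),
      randomSubsetWeight n (coverageDensity n) T *
        (if (s i T).1 = some u then (0 : ℝ) else 1)) := by
  have hw : (∑ θ : Fin n → Finset (Fin n), ∏ i, randomSubsetWeight n (coverageDensity n) (θ i)) = 1 :=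
    (coverageGame n).prior_mem.2
  change ∑ θ : Fin n → Finset (Fin n), (∏ i, randomSubsetWeight n (coverageDensity n) (θ i)) *
    coverage n ((fun j => ⟨j, ⟨θ j, s j (θ j)⟩⟩) '' Set.univ) = _
  simp_rw [coverage_image_univ, Finset.mul_sum]
  rw [Finset.sum_comm]
  refine Finset.sum_congr rfl fun u _ => ?_
  simp_rw [mul_sub, mul_one, ← Finset.prod_mul_distrib]
  rw [Finset.sum_sub_distrib, hw, Finset.prod_univ_sum, Fintype.piFinset_univ]

theorem coverageGame_bestStrategyWelfare_le (n : ℕ) (hp : coverageDensity n < 1) :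
    (coverageGame n).bestStrategyWelfare ≤
      n * (1 - Real.exp (-(1 - coverageDensity n)⁻¹)) := by
  refine ciSup_le fun s => ?_
  rw [coverageGame_strategyWelfare, Finset.sum_sub_distrib]
  have hw := randomSubsetWeight_mem n _ (coverageDensity_nonneg n) hp.le
  set w := randomSubsetWeight n (coverageDensity n) with hwdef
  have hr1 : ∀ (i u : Fin n), 1 - ∑ T : Finset (Fin n),
      w T * (if (s i T).1 = some u then (0 : ℝ) else 1) =
      ∑ T : Finset (Fin n), w T * (if (s i T).1 = some u then (1 : ℝ) else 0) := by
    intro i u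
    rw [sub_eq_iff_eq_add, ← Finset.sum_add_distrib]
    refine hw.2.symm.trans (Finset.sum_congr rfl fun T _ => ?_)
    split_ifs <;> simp
  have key := mul_exp_le_sum_prod hp (fun i u : Fin n => ∑ T : Finset (Fin n),
      w T * (if (s i T).1 = some u then (0 : ℝ) else 1)) ?_ ?_ ?_
  · simp only [Finset.sum_const, Finset.card_univ, Fintype.card_fin, nsmul_eq_mul, mul_one]
    linarith
  · intro i u
    -- Choosing `u` requires `u ∈ T`, and the event `u ∉ T` has probability `1 - p`.
    have hu := sum_powerset_randomSubsetWeight (coverageDensity n) (Finset.univ.erase u)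
    have hn : n - (Finset.univ.erase u).card = 1 := by
      rw [Finset.card_erase_of_mem (Finset.mem_univ u), Finset.card_univ, Fintype.card_fin]
      have := u.pos
      omega
    rw [hn, pow_one] at hu
    rw [← hu, ← hwdef]
    calc _ = ∑ T ∈ (Finset.univ.erase u).powerset,
          w T * (if (s i T).1 = some u then (0 : ℝ) else 1) := by
          refine Finset.sum_congr rfl fun T hT => ?_
          rw [if_neg, mul_one]
          intro h
          exact Finset.notMem_erase u _ (Finset.mem_powerset.1 hT ((s i T).2.1 u h))
      _ ≤ _ := Finset.sum_le_univ_sum_of_nonneg fun T =>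
          mul_nonneg (hw.1 T) (by split_ifs <;> norm_num)
  · intro i u
    rw [← sub_nonneg, hr1]
    exact Finset.sum_nonneg fun T _ => mul_nonneg (hw.1 T) (by split_ifs <;> norm_num)
  · intro i
    simp_rw [hr1]
    rw [Finset.sum_comm]
    refine (Finset.sum_le_sum fun T _ => ?_).trans hw.2.le
    rw [← Finset.mul_sum]
    refine mul_le_of_le_one_right (hw.1 T) ?_
    rcases h : (s i T).1 with _ | v
    · simp
    · simp

/-! ### Greedy covering and the optimal welfare. -/

/-- The elements covered when players choose greedily, one after the other, an element of their
sets that is not yet covered. -/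
noncomputable def greedyCover {n : ℕ} : (m : ℕ) → (Fin m → Finset (Fin n)) → Finset (Fin n)
  | 0, _ => ∅
  | m + 1, θ =>
    open Classical in
    -- Player `0` moves last, after the players of the tail.
    if h : (θ 0 \ greedyCover m (Fin.tail θ)).Nonempty then
      insert h.choose (greedyCover m (Fin.tail θ))
    else greedyCover m (Fin.tail θ)

theorem card_greedyCover_succ {n m : ℕ} (θ : Fin (m + 1) → Finset (Fin n)) :
    (greedyCover (m + 1) θ).card = (greedyCover m (Fin.tail θ)).card +
      if θ 0 ∈ (greedyCover m (Fin.tail θ)).powerset then 0 else 1 := by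
  rw [greedyCover]
  split_ifs with h1 h2 h2
  · exact absurd h1 (by simpa [Finset.sdiff_eq_empty_iff_subset] using h2)
  · exact Finset.card_insert_of_notMem (Finset.mem_sdiff.1 h1.choose_spec).2
  · rfl
  · exact absurd (by simpa [Finset.not_nonempty_iff_eq_empty, Finset.sdiff_eq_empty_iff_subset]
      using h1) h2

theorem card_greedyCover_le {n : ℕ} :
    ∀ (m : ℕ) (θ : Fin m → Finset (Fin n)), (greedyCover m θ).card ≤ m
  | 0, _ => by simp [greedyCover]
  | m + 1, θ => by
    rw [card_greedyCover_succ]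
    have := card_greedyCover_le m (Fin.tail θ)
    split_ifs <;> omega

theorem exists_actions_greedyCover {n : ℕ} : ∀ (m : ℕ) (θ : Fin m → Finset (Fin n)),
    ∃ a : ∀ i, CoverageAction n (θ i), ∀ u ∈ greedyCover m θ, ∃ i, (a i).1 = some u
  | 0, _ => ⟨fun i => i.elim0, by simp [greedyCover]⟩
  | m + 1, θ => by
    obtain ⟨a, ha⟩ := exists_actions_greedyCover m (Fin.tail θ)
    rw [greedyCover]
    split_ifs with h
    · have h0 := (Finset.mem_sdiff.1 h.choose_spec).1
      refine ⟨Fin.cons (α := fun i => CoverageAction n (θ i))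
        ⟨some h.choose, fun u hu => Option.some.inj hu ▸ h0, by simp⟩ a, fun u hu => ?_⟩
      rcases Finset.mem_insert.1 hu with rfl | hu
      · exact ⟨0, rfl⟩
      · obtain ⟨i, hi⟩ := ha u hu
        exact ⟨i.succ, hi⟩
    · refine ⟨Fin.cons (α := fun i => CoverageAction n (θ i))
        (coverageAction_nonempty n (θ 0)).some a, fun u hu => ?_⟩
      obtain ⟨i, hi⟩ := ha u hu
      exact ⟨i.succ, hi⟩

/-- The additional player fails only if her set lies inside the current cover `C`. Her set is
independent of `C`, so this has conditional probability `(1 - p) ^ (n - C.card)`, and `C.card ≤ m`.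
-/
theorem expected_greedyCover_succ {n : ℕ} (m : ℕ) {p : ℝ} (h0 : 0 ≤ p) (h1 : p ≤ 1) :
    ∑ θ : Fin m → Finset (Fin n), (∏ i, randomSubsetWeight n p (θ i)) * (greedyCover m θ).card +
        1 - (1 - p) ^ (n - m) ≤
      ∑ θ : Fin (m + 1) → Finset (Fin n),
        (∏ i, randomSubsetWeight n p (θ i)) * (greedyCover (m + 1) θ).card := by
  have hw := randomSubsetWeight_mem n p h0 h1
  have hP := prod_mem_stdSimplex (n := m) _ hw
  rw [← (Fin.consEquiv fun _ => Finset (Fin n)).sum_comp, Fintype.sum_prod_type,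
    Finset.sum_comm]
  have e : ∀ (T : Finset (Fin n)) (θ : Fin m → Finset (Fin n)),
      (∏ i, randomSubsetWeight n p (Fin.cons (α := fun _ => Finset (Fin n)) T θ i)) *
        (greedyCover (m + 1) (Fin.cons (α := fun _ => Finset (Fin n)) T θ)).card =
      (∏ i, randomSubsetWeight n p (θ i)) * (randomSubsetWeight n p T *
        ((greedyCover m θ).card + 1) -
        if T ∈ (greedyCover m θ).powerset then randomSubsetWeight n p T else 0) := by
    intro T θ
    rw [Fin.prod_univ_succ, card_greedyCover_succ]
    simp only [Fin.cons_zero, Fin.cons_succ, Fin.tail_cons]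
    split_ifs <;> push_cast <;> ring
  refine le_trans ?_ (Finset.sum_congr rfl fun θ _ =>
    Finset.sum_congr rfl fun T _ => (e T θ).symm).le
  have e2 : ∀ θ : Fin m → Finset (Fin n), ∑ T, (∏ i, randomSubsetWeight n p (θ i)) *
      (randomSubsetWeight n p T * ((greedyCover m θ).card + 1) -
        if T ∈ (greedyCover m θ).powerset then randomSubsetWeight n p T else 0) =
      (∏ i, randomSubsetWeight n p (θ i)) * ((greedyCover m θ).card + 1 -
        (1 - p) ^ (n - (greedyCover m θ).card)) := by
    intro θ
    rw [← Finset.mul_sum, Finset.sum_sub_distrib, ← Finset.sum_mul, hw.2, one_mul,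
      ← Finset.sum_filter, Finset.filter_mem_eq_inter, Finset.univ_inter,
      sum_powerset_randomSubsetWeight]
  simp_rw [e2]
  have e3 : ∑ θ : Fin m → Finset (Fin n), (∏ i, randomSubsetWeight n p (θ i)) *
      (greedyCover m θ).card + 1 - (1 - p) ^ (n - m) =
      ∑ θ : Fin m → Finset (Fin n), (∏ i, randomSubsetWeight n p (θ i)) *
        ((greedyCover m θ).card + 1 - (1 - p) ^ (n - m)) := by
    simp_rw [add_sub_assoc, mul_add, Finset.sum_add_distrib]
    rw [← Finset.sum_mul, hP.2, one_mul]
  rw [e3]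
  refine Finset.sum_le_sum fun θ _ => mul_le_mul_of_nonneg_left ?_ (hP.1 θ)
  refine sub_le_sub_left (pow_le_pow_of_le_one (by linarith) (by linarith) ?_) _
  have := card_greedyCover_le m θ
  omega

/-- The expected number of failures is bounded by a geometric sum with ratio `1 - p`, dominated by
its last terms. -/
theorem mul_sub_expected_greedyCover_le {n : ℕ} {p : ℝ} (h0 : 0 ≤ p) (h1 : p ≤ 1) (m : ℕ)
    (hm : m ≤ n) :
    p * (m - ∑ θ : Fin m → Finset (Fin n), (∏ i, randomSubsetWeight n p (θ i)) *
      (greedyCover m θ).card) ≤ (1 - p) ^ (n - m) := by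
  induction m with
  | zero => simpa [greedyCover] using pow_nonneg (sub_nonneg.2 h1) n
  | succ m ih =>
    have h2 := mul_le_mul_of_nonneg_left (expected_greedyCover_succ (n := n) m h0 h1) h0
    have h3 := ih (by omega)
    obtain ⟨k, rfl⟩ := Nat.exists_eq_add_of_le hm
    rw [show m + 1 + k - m = k + 1 by omega, pow_succ] at h2 h3
    rw [show m + 1 + k - (m + 1) = k by omega]
    -- The slack of the induction step: `(1 - p) ^ (k + 1) * (1 + p) = (1 - p) ^ k * (1 - p ^ 2)`.
    have h4 : 0 ≤ (1 - p) ^ k * p ^ 2 := mul_nonneg (pow_nonneg (sub_nonneg.2 h1) k) (sq_nonneg p)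
    push_cast
    nlinarith

theorem coverageGame_le_optWelfare (n : ℕ) :
    coverageDensity n * (n - (coverageGame n).optWelfare) ≤ 1 := by
  have h0 := coverageDensity_nonneg n
  have h := mul_sub_expected_greedyCover_le h0 (coverageDensity_le_one n) n le_rfl
  rw [Nat.sub_self, pow_zero] at h
  refine le_trans (mul_le_mul_of_nonneg_left (sub_le_sub_left ?_ _) h0) h
  refine Finset.sum_le_sum fun θ _ =>
    mul_le_mul_of_nonneg_left ?_ ((coverageGame n).prior_mem.1 θ)
  obtain ⟨a, ha⟩ := exists_actions_greedyCover n θ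
  refine le_trans ?_ ((coverageGame n).SW_le_iSup (θ := θ) a)
  refine Nat.cast_le.2 ?_
  rw [← Set.ncard_coe_finset]
  refine Set.ncard_le_ncard (fun u hu => ?_) (Set.toFinite _)
  obtain ⟨i, hi⟩ := ha u hu
  exact ⟨⟨i, ⟨θ i, a i⟩⟩, ⟨i, Set.mem_univ _, rfl⟩, hi⟩

theorem coverageGame_mul_le_optWelfare {n : ℕ} (hn : 2 ≤ n) :
    n * (1 - (2 * Real.log n)⁻¹) ≤ (coverageGame n).optWelfare := by
  have hn' : (0 : ℝ) < n := by exact_mod_cast (by omega : 0 < n)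
  have hlog : 0 < Real.log n := Real.log_pos (by exact_mod_cast hn)
  have h := coverageGame_le_optWelfare n
  rw [coverageDensity, div_mul_eq_mul_div, div_le_iff₀ hn', one_mul,
    ← le_div_iff₀' (by positivity)] at h
  have : n * (1 - (2 * Real.log n)⁻¹) = n - n / (2 * Real.log n) := by ring
  linarith

/-- The factor `2` in the density matters here: `2 * log 2 > 1`, while `log 2 < 1`, so the bound is
already positive at `n = 2`. -/
theorem one_sub_inv_two_log_pos {n : ℕ} (hn : 2 ≤ n) : 0 < 1 - (2 * Real.log n)⁻¹ := by
  have h2 : Real.log 2 ≤ Real.log n := Real.log_le_log two_pos (by exact_mod_cast hn)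
  have := Real.log_two_gt_d9
  exact sub_pos.2 (inv_lt_one_of_one_lt₀ (by linarith))

theorem coverageGame_optWelfare_pos {n : ℕ} (hn : 2 ≤ n) : 0 < (coverageGame n).optWelfare :=
  (mul_pos (by exact_mod_cast (by omega : 0 < n)) (one_sub_inv_two_log_pos hn)).trans_le
    (coverageGame_mul_le_optWelfare hn)

/-! ### The limit of the SR gap and tightness. -/

theorem coverageGame_srGap_le {n : ℕ} (hn : 2 ≤ n) (hp : coverageDensity n < 1) :
    (coverageGame n).srGap ≤
      (1 - Real.exp (-(1 - coverageDensity n)⁻¹)) / (1 - (2 * Real.log n)⁻¹) := by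
  have hn' : (0 : ℝ) < n := by exact_mod_cast (by omega : 0 < n)
  have hpos := one_sub_inv_two_log_pos hn
  have h1 : 0 ≤ 1 - Real.exp (-(1 - coverageDensity n)⁻¹) :=
    sub_nonneg.2 (Real.exp_le_one_iff.2 (neg_nonpos.2 (inv_nonneg.2 (sub_pos.2 hp).le)))
  calc (coverageGame n).srGap ≤ n * (1 - Real.exp (-(1 - coverageDensity n)⁻¹)) /
        (n * (1 - (2 * Real.log n)⁻¹)) :=
        div_le_div₀ (mul_nonneg hn'.le h1) (coverageGame_bestStrategyWelfare_le n hp)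
          (mul_pos hn' hpos) (coverageGame_mul_le_optWelfare hn)
    _ = _ := mul_div_mul_left _ _ hn'.ne'

theorem tendsto_coverageDensity :
    Filter.Tendsto coverageDensity Filter.atTop (nhds 0) := by
  have h : Filter.Tendsto (fun x : ℝ => 2 * (Real.log x / x)) Filter.atTop (nhds (2 * 0)) := by
    refine Filter.Tendsto.const_mul 2 ?_
    simpa using Real.tendsto_pow_log_div_mul_add_atTop 1 0 1 one_ne_zero
  rw [mul_zero] at h
  refine (h.comp tendsto_natCast_atTop_atTop).congr fun n => ?_
  simp [coverageDensity, mul_div_assoc]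

theorem tendsto_coverageGame_srGap :
    Filter.Tendsto (fun n : ℕ => (coverageGame n).srGap) Filter.atTop
      (nhds (1 - 1 / Real.exp 1)) := by
  have hlog : Filter.Tendsto (fun n : ℕ => (2 * Real.log n)⁻¹) Filter.atTop (nhds 0) :=
    ((Real.tendsto_log_atTop.comp tendsto_natCast_atTop_atTop).const_mul_atTop
      two_pos).inv_tendsto_atTop
  have hexp : Filter.Tendsto (fun n : ℕ => 1 - Real.exp (-(1 - coverageDensity n)⁻¹))
      Filter.atTop (nhds (1 - 1 / Real.exp 1)) := by
    have h1 := ((tendsto_coverageDensity.const_sub 1).inv₀ (by norm_num)).neg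
    have h2 := ((Real.continuous_exp.tendsto _).comp h1).const_sub 1
    simpa [Real.exp_neg, Function.comp_def] using h2
  have hup := hexp.div (hlog.const_sub 1) (by norm_num)
  rw [sub_zero, div_one] at hup
  refine tendsto_of_tendsto_of_tendsto_of_le_of_le' tendsto_const_nhds hup ?_ ?_
  · filter_upwards [Filter.eventually_ge_atTop 2] with n hn
    exact (coverageGame n).le_srGap (coverageGame_hasSubmodularWelfare n)
      (coverageGame_isIndependent n) (coverageGame_optWelfare_pos hn)
  · filter_upwards [Filter.eventually_ge_atTop 2,
      tendsto_coverageDensity.eventually_lt_const one_pos] with n hn hp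
    exact coverageGame_srGap_le hn hp

theorem mainTheorem10 :
    (∀ n : ℕ, (coverageGame n).IsValidUtilityGame ∧ (coverageGame n).IsIndependent) ∧
    (∀ n : ℕ, 2 ≤ n → 0 < (coverageGame n).optWelfare) ∧
    Filter.Tendsto (fun n : ℕ => (coverageGame n).srGap) Filter.atTop
      (nhds (1 - 1 / Real.exp 1)) ∧
    IsGLB {r : ℝ | ∃ G : BayesianGame, G.IsValidUtilityGame ∧ G.IsIndependent ∧
        0 < G.optWelfare ∧ r = G.srGap}
      (1 - 1 / Real.exp 1) := by
  refine ⟨fun n => ⟨coverageGame_isValidUtilityGame n, coverageGame_isIndependent n⟩,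
    fun n hn => coverageGame_optWelfare_pos hn, tendsto_coverageGame_srGap, ?_, fun b hb => ?_⟩
  · rintro r ⟨G, hG, hI, h0, rfl⟩
    exact G.le_srGap hG.1 hI h0
  -- A lower bound of all gaps bounds those of the coverage games with `n ≥ 2`, hence also their
  -- limit; the infimum need not be attained.
  · refine ge_of_tendsto tendsto_coverageGame_srGap ?_
    filter_upwards [Filter.eventually_ge_atTop 2] with n hn
    exact hb ⟨coverageGame n, coverageGame_isValidUtilityGame n, coverageGame_isIndependent n,
      coverageGame_optWelfare_pos hn, rfl⟩
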